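/- Let $k$ be a field and let $X$ be a reduced scheme of finite type over $k$, of pure dimension $n$ (for instance a variety of dimension $n$). A *stratification* $\Sigma$ of $X$ is a sequence of morphisms $$X_0 \xrightarrow{f_0} X_1 \xrightarrow{f_1} \cdots \xrightarrow{f_{n-1}} X_n \xrightarrow{q} X$$ where each $X_i$ is a normal scheme of pure dimension $i$, $q$ is proper and birational, and each $f_i$ factors as a proper birational morphism $X_i \to D_{i+1}$ followed by the inclusion of a reduced Weil divisor $D_{i+1} \subset X_{i+1}$ (possibly empty). Let $q_i : X_i \to X$ be the composite map and $U_i = X_i \setminus f_{i-1}(X_{i-1})$ (with $X_{-1} = \emptyset$). Let $L$ be a $\mathbb{Q}$-line bundle on $X$, that is, an element of $\mathrm{Pic}(X) \otimes \mathbb{Q}$. A *trivialization* $\frac1d \mathbf{e}$ of $L$ over $\Sigma$ consists of an integer $d \ge 1$, a line bundle $M$ on $X$ whose class in $\mathrm{Pic}(X) \otimes \mathbb{Q}$ is $L^{\otimes d}$, and, for each $0 \le i \le n$, a trivialization $e_i$ of $q_i^* M$ over $U_i$. Write $\underline{\Sigma} = (\Sigma, \frac1d \mathbf{e})$. The *tree*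 $\mathcal{T}$ of $\Sigma$ has as nodes the irreducible components of all the $X_i$; a component $W$ of $X_i$ is a child of the component $V$ of $X_{i+1}$ if $f_i(W) \subseteq V$. The roots are the components of $X_n$ (there is only one when $X$ is irreducible), and the leaves are the components of $X_0$. The edge from $W$ to $V$ is marked by the rational number $m/d$, where $m \in \mathbb{Z}$ is the multiplicity of $e_{i+1}$, seen as a rational section of $q_{i+1}^* M|_V$, at the generic point of $f_i(W)$. A *root-to-leaf path* is a sequence $\sigma = (V_n, V_{n-1}, \dots, V_0)$ with $V_i$ a component of $X_i$ and $V_i$ a child of $V_{i+1}$ for all $i < n$. Its *index* is the number of its edges with a (strictly) negative marking, $C_\sigma$ is the product of its $n$ markings (so $C_\sigma = 1$ if $n = 0$), and $\deg(\sigma) = [\mathbb{K} : k]$, where $V_0 = \mathrm{Spec}\, \mathbb{K}$. Let $Z^\Sigma_\bullet(X)_{\mathbb{Q}} = \bigoplus_{0 \le k \le n} \bigoplus_{V} \mathbb{Q} \cdot [V]$, where $V$ runs through the irreducible components of $X_k$. For a component $V$ of $X_{i}$ with children $W_1, \dots, W_r$, whose edges have multiplicities $m_1, \dots, m_r$, put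 $$c_1(L, \underline{\Sigma})_{[l]}([V]) = \sum_{j \,:\, (-1)^l m_j > 0} \frac{m_j}{d}\, [W_j] \quad \text{for } l \in \{0, 1\}$$ (which is $0$ if $i = 0$), and $c_1(L, \underline{\Sigma})_{[l]} = 0$ for all other integers $l$. Define endomorphisms $c_1(L, \underline{\Sigma})^k_{[l]}$ of $Z^\Sigma_\bullet(X)_{\mathbb{Q}}$, for $k \in \mathbb{N}$ and $l \in \mathbb{Z}$, by $c_1(L, \underline{\Sigma})^0_{[0]} = \mathrm{id}$, $c_1(L, \underline{\Sigma})^0_{[l]} = 0$ for $l \ne 0$, and $$c_1(L, \underline{\Sigma})^{k+1}_{[l]} = c_1(L, \underline{\Sigma})^{k}_{[l]} \circ c_1(L, \underline{\Sigma})_{[0]} + c_1(L, \underline{\Sigma})^{k}_{[l-1]} \circ c_1(L, \underline{\Sigma})_{[1]}.$$ Let $[X]$ be the sum of the components of $X_n$, and let $\deg c_1(L, \underline{\Sigma})^n_{[l]} = \sum_V \alpha_V [\mathbb{K}_V : k]$ if $c_1(L, \underline{\Sigma})^n_{[l]}([X]) = \sum_V \alpha_V [V]$, where $V = \mathrm{Spec}\,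 \mathbb{K}_V$ runs through the components of $X_0$. Then, for every integer $l$, $$\deg c_1(L, \underline{\Sigma})^n_{[l]} = \sum_{\mathrm{index}(\sigma) = l} C_\sigma \, \deg(\sigma),$$ where $\sigma$ runs through the root-to-leaf paths of $\mathcal{T}$ of index $l$. -/

import Mathlib

/-!
Stratifications of schemes over a field, fractional trivializations of `ℚ`-line bundles on them,
the associated tree with its markings, and truncated first Chern classes.
-/

open CategoryTheory AlgebraicGeometry TopologicalSpace

universe u

namespace StratifiedChern

variable {X Y : Scheme.{u}}

section LineBundles

/-! ### Line bundles, frames and `ℚ`-line bundles -/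

/-- The structure sheaf `𝒪_X` as a module over itself. -/
noncomputable def structureSheaf (X : Scheme.{u}) : X.Modules :=
  SheafOfModules.unit X.ringCatSheaf

/-- A line bundle: a sheaf of modules that is locally isomorphic to the structure sheaf. -/
def IsLineBundle (M : X.Modules) : Prop :=
  ∀ x : X, ∃ U : X.Opens, x ∈ U ∧ Nonempty (M.restrict U.ι ≅ structureSheaf U)

/-- A trivialization (frame) of a line bundle `M` over an open `U`: a section `s` over `U` such
that `a ↦ a • s` is an isomorphism from `𝒪_U` to `M|_U`. -/
def IsFrame {M : X.Modules} {U : X.Opens} (s : Γ(M, U)) : Prop :=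
  ∀ (V : X.Opens) (h : V ≤ U),
    Function.Bijective fun a : Γ(X, V) => a • M.presheaf.map (homOfLE h).op s

/-- The tensor product of sheaves of modules: the sheafification of the presheaf
`U ↦ Γ(M, U) ⊗ Γ(N, U)`. -/
noncomputable def tensor (M N : X.Modules) : X.Modules :=
  (PresheafOfModules.sheafification (𝟙 X.ringCatSheaf.obj)).obj
    (MonoidalCategory.tensorObj
      (C := _root_.PresheafOfModules.{u} (X.presheaf ⋙ forget₂ CommRingCat RingCat))
      M.val N.val)

/-- The tensor power `M^{⊗ m}`. -/
noncomputable def tensorPow (M : X.Modules) : ℕ → X.Modules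
  | 0 => structureSheaf X
  | m + 1 => tensor (tensorPow M m) M

/-- A `ℚ`-line bundle, that is an element of `Pic(X) ⊗ ℚ`, given by a line bundle `L₀` and an
integer `d₀ ≥ 1`; it stands for `(1 / d₀) [L₀]`. -/
structure QLineBundle (X : Scheme.{u}) where
  /-- the line bundle `L₀` -/
  bundle : X.Modules
  isLineBundle : IsLineBundle bundle
  /-- the denominator `d₀` -/
  den : ℕ
  den_pos : 0 < den

/-- `N^{⊗ d}` is the image of the line bundle `L` in `Pic(X) ⊗ ℚ`: for `N = (1 / d₀) [L₀]` this
means that `d [L₀] = d₀ [L]` in `Pic(X)` up to torsion. -/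
def QLineBundle.PowComesFrom (N : QLineBundle X) (d : ℕ) (L : X.Modules) : Prop :=
  ∃ m : ℕ, 0 < m ∧ Nonempty (tensorPow N.bundle (m * d) ≅ tensorPow L (m * N.den))

instance (f : X ⟶ Y) : (Opens.map f.base).Final where
  out V := by
    let T : StructuredArrow V (Opens.map f.base) := StructuredArrow.mk (Y := ⊤) (homOfLE le_top)
    have : Nonempty (StructuredArrow V (Opens.map f.base)) := ⟨T⟩
    exact zigzag_isConnected fun a b =>
      (Zigzag.of_hom (StructuredArrow.homMk (homOfLE le_top) (Subsingleton.elim _ _) : a ⟶ T)).trans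
      (Zigzag.of_inv (StructuredArrow.homMk (homOfLE le_top) (Subsingleton.elim _ _) : b ⟶ T))

theorem nonempty_pullback_structureSheaf_iso (f : X ⟶ Y) :
   Nonempty ((Scheme.Modules.pullback f).obj (structureSheaf Y) ≅ structureSheaf X) := by
  have h : (Scheme.Modules.pushforward f).IsRightAdjoint := inferInstance
  have h2 : (SheafOfModules.pushforward.{u} f.toRingCatSheafHom).IsRightAdjoint := h
  have h3 := @SheafOfModules.instIsIsoPullbackObjUnitToUnitOfFinal _ _ _ _ _ _ _ _ _ _ f.toRingCatSheafHom h2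
  exact ⟨@asIso _ _ _ _ (@SheafOfModules.pullbackObjUnitToUnit _ _ _ _ _ _ _ _ _ _ f.toRingCatSheafHom h2) h3⟩

theorem IsLineBundle.pullback (f : X ⟶ Y) {M : Y.Modules} (hM : IsLineBundle M) :
    IsLineBundle ((Scheme.Modules.pullback f).obj M) := by
  intro x
  obtain ⟨U, hxU, ⟨e⟩⟩ := hM (f x)
  refine ⟨f ⁻¹ᵁ U, hxU, ?_⟩
  obtain ⟨e'⟩ := nonempty_pullback_structureSheaf_iso (f ∣_ U)
  refine ⟨(Scheme.Modules.restrictFunctorIsoPullback _).app _ ≪≫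
    (Scheme.Modules.pullbackComp (f ⁻¹ᵁ U).ι f).app M ≪≫
    (Scheme.Modules.pullbackCongr (morphismRestrict_ι f U).symm).app M ≪≫
    ((Scheme.Modules.pullbackComp (f ∣_ U) U.ι).symm).app M ≪≫
    (Scheme.Modules.pullback (f ∣_ U)).mapIso
      (((Scheme.Modules.restrictFunctorIsoPullback U.ι).symm).app M ≪≫ e) ≪≫ e'⟩

theorem IsLineBundle.exists_isFrame {M : X.Modules} (hM : IsLineBundle M) (x : X) :
    ∃ (U : X.Opens) (_ : x ∈ U) (s : Γ(M, U)), IsFrame s := by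
  obtain ⟨U, hxU, ⟨e⟩⟩ := hM x
  have hU : U = U.ι ''ᵁ ⊤ := by simp
  let s₀ : Γ(M.restrict U.ι, ⊤) := e.inv.app ⊤ (1 : Γ(U.toScheme, ⊤))
  let s : Γ(M, U.ι ''ᵁ ⊤) := s₀
  refine ⟨U.ι ''ᵁ ⊤, by simpa using hxU, s, ?_⟩
  intro V h
  obtain ⟨V, rfl⟩ : ∃ V' : U.toScheme.Opens, U.ι ''ᵁ V' = V := by
    refine ⟨U.ι ⁻¹ᵁ V, ?_⟩
    rw [Scheme.Hom.image_preimage_eq_opensRange_inf]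
    simpa using h
  have key : ∀ a : Γ(U.toScheme, V), e.inv.app V a =
      (show Γ(X, U.ι ''ᵁ V) from a) • M.presheaf.map (homOfLE h).op s := by
    intro a
    have h1 := Scheme.Modules.Hom.app_smul e.inv (U := V) a
      (show Γ(structureSheaf U.toScheme, V) from (1 : Γ(U.toScheme, V)))
    have h2 : e.inv.app V (show Γ(structureSheaf U.toScheme, V) from (1 : Γ(U.toScheme, V)))
        = M.presheaf.map (homOfLE h).op s := by
      have := ConcreteCategory.congr_hom
        (e.inv.mapPresheaf.naturality (homOfLE (le_top : V ≤ ⊤)).op)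
        (show Γ(structureSheaf U.toScheme, ⊤) from (1 : Γ(U.toScheme, ⊤)))
      refine Eq.trans ?_ this
      refine congrArg (e.inv.app V) ?_
      exact (map_one (U.toScheme.presheaf.map (homOfLE (le_top : V ≤ ⊤)).op).hom).symm
    have h3 : a • (show Γ(structureSheaf U.toScheme, V) from (1 : Γ(U.toScheme, V))) = a :=
      mul_one (show Γ(U.toScheme, V) from a)
    rw [h3, h2] at h1
    refine h1.trans ?_
    have h4 : (U.ι.appIso V).inv.hom (show Γ(U.toScheme, V) from a) = a := by
      rw [Scheme.Opens.ι_appIso]; rfl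
    exact congrArg (fun b : Γ(X, U.ι ''ᵁ V) => b • M.presheaf.map (homOfLE h).op s) h4
  have hb : Function.Bijective (e.inv.app V) := by
    have : IsIso (e.inv.app V) := inferInstance
    exact ConcreteCategory.bijective_of_isIso (e.inv.app V)
  have : (fun a : Γ(X, U.ι ''ᵁ V) => a • M.presheaf.map (homOfLE h).op s) = e.inv.app V := by
    funext a
    exact (key a).symm
  rw [this]
  exact hb

end LineBundles

section Normal

/-! ### Normal schemes, components and orders of vanishing -/

/-- All local rings are integrally closed domains. -/
class IsNormal (X : Scheme.{u}) : Prop where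
  isDomain (x : X) : IsDomain (X.presheaf.stalk x)
  isIntegrallyClosed (x : X) : IsIntegrallyClosed (X.presheaf.stalk x)

instance [IsNormal X] : AlgebraicGeometry.IsReduced X := by
  have : ∀ x : X, _root_.IsReduced (X.presheaf.stalk x) := fun x =>
    have := IsNormal.isDomain x
    inferInstance
  exact isReduced_of_isReduced_stalk X

theorem eq_of_mem_irreducibleComponents [IsNormal X] {Z Z' : Set X}
    (hZ : Z ∈ irreducibleComponents X) (hZ' : Z' ∈ irreducibleComponents X)
    {x : X} (hx : x ∈ Z) (hx' : x ∈ Z') : Z = Z' := by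
  have := IsNormal.isDomain x
  let ζ : X := X.fromSpecStalk x (⊥ : PrimeSpectrum (X.presheaf.stalk x))
  have key : ∀ T ∈ irreducibleComponents X, x ∈ T → T = closure {ζ} := by
    intro T hT hxT
    have hTc := isClosed_of_mem_irreducibleComponents T hT
    obtain ⟨ξ, hξ⟩ := QuasiSober.sober hT.1 hTc
    have h1 : ξ ⤳ x := hξ.specializes hxT
    have h2 : ξ ∈ Set.range (X.fromSpecStalk x) := by
      rw [Scheme.range_fromSpecStalk]; exact h1
    obtain ⟨p, rfl⟩ := h2
    have h3 : ζ ⤳ X.fromSpecStalk x p := by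
      refine Specializes.map ?_ (X.fromSpecStalk x).continuous
      exact (PrimeSpectrum.le_iff_specializes _ _).1 bot_le
    have h4 : T ⊆ closure {ζ} := by
      rw [← hξ.def]; exact h3.closure_subset
    exact h4.antisymm (hT.2 isIrreducible_singleton.closure h4)
  rw [key Z hZ hx, key Z' hZ' hx']

/-- An irreducible component `V` of a normal Noetherian scheme, as an open subscheme. -/
noncomputable def componentOpen [IsNoetherian X] (V : irreducibleComponents X) : X.Opens :=
  X.irreducibleComponentOpen V.1

theorem mem_componentOpen [IsNoetherian X] [IsNormal X] (V : irreducibleComponents X) (x : X) :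
    x ∈ componentOpen V ↔ x ∈ V.1 := by
  change x ∈ (⋃₀ (irreducibleComponents X \ {V.1}))ᶜ ↔ _
  constructor
  · intro h
    by_contra hx
    refine h ⟨irreducibleComponent x, ⟨irreducibleComponent_mem_irreducibleComponents x, ?_⟩,
      mem_irreducibleComponent⟩
    rintro (h' : _ = _)
    exact hx (h' ▸ mem_irreducibleComponent)
  · rintro h ⟨T, ⟨hT, hT'⟩, hx⟩
    exact hT' (eq_of_mem_irreducibleComponents hT V.2 hx h)

instance [IsNoetherian X] [IsNormal X] (V : irreducibleComponents X) :
    AlgebraicGeometry.IsIntegral (componentOpen V).toScheme := by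
  have h : ((componentOpen V : X.Opens) : Set X) = V.1 := Set.ext (mem_componentOpen V)
  have : IrreducibleSpace (componentOpen V).toScheme :=
    isIrreducible_iff_irreducibleSpace.mp (h ▸ V.2.1)
  exact isIntegral_of_irreducibleSpace_of_isReduced _

/-- The generic point of an irreducible component. -/
noncomputable def componentGenericPoint (V : irreducibleComponents X) : X :=
  V.2.1.genericPoint

theorem isGenericPoint_componentGenericPoint (V : irreducibleComponents X) :
    IsGenericPoint (componentGenericPoint V) V.1 :=
  V.2.1.isGenericPoint_genericPoint (isClosed_of_mem_irreducibleComponents _ V.2)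

/-- The unique function `f` on `W ⊓ U` with `s = f • t`, where `t` is a frame over `W` and `s` a
section over `U`. -/
noncomputable def ratio {M : X.Modules} {U W : X.Opens} (s : Γ(M, U)) (t : Γ(M, W))
    (ht : IsFrame t) : Γ(X, W ⊓ U) :=
  (Equiv.ofBijective _ (ht (W ⊓ U) inf_le_left)).symm
    (M.presheaf.map (homOfLE inf_le_right).op s)

theorem ratio_smul {M : X.Modules} {U W : X.Opens} (s : Γ(M, U)) (t : Γ(M, W))
    (ht : IsFrame t) :
    ratio s t ht • M.presheaf.map (homOfLE (inf_le_left : W ⊓ U ≤ W)).op t =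
      M.presheaf.map (homOfLE (inf_le_right : W ⊓ U ≤ U)).op s :=
  (Equiv.ofBijective _ (ht (W ⊓ U) inf_le_left)).apply_symm_apply _

theorem nonempty_preimage_componentOpen [IsNoetherian X] [IsNormal X]
    (V : irreducibleComponents X) {U W : X.Opens} (hU : componentGenericPoint V ∈ U) {η : X}
    (hη : η ∈ V.1) (hW : η ∈ W) :
    Nonempty ((componentOpen V).ι ⁻¹ᵁ (W ⊓ U)).toScheme := by
  have hξ := isGenericPoint_componentGenericPoint V
  have h1 : componentGenericPoint V ∈ componentOpen V := (mem_componentOpen V _).2 hξ.mem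
  exact ⟨⟨⟨_, h1⟩, (hξ.specializes hη).mem_open W.2 hW, hU⟩⟩

/-- Let `V` be a component of a normal Noetherian scheme, `M` a line bundle, `s` a section of `M`
over an open `U` that meets `V`, and `η` a point of `V`. Then `s` is a rational section of `M|_V`,
and this is its multiplicity at `η`: write `s = f • t` for a frame `t` of `M` near `η` and take
the order at `η` of the rational function `f` on the integral scheme `V`. The order does not
depend on `t`, since two frames differ by a unit. -/
noncomputable def multiplicityAt [IsNoetherian X] [IsNormal X] (V : irreducibleComponents X)
    {M : X.Modules} (hM : IsLineBundle M) {U : X.Opens} (hU : componentGenericPoint V ∈ U)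
    (s : Γ(M, U)) (η : X) (hη : η ∈ V.1) : ℤ :=
  let W : X.Opens := (hM.exists_isFrame η).choose
  have hW : η ∈ W := (hM.exists_isFrame η).choose_spec.choose
  let t : Γ(M, W) := (hM.exists_isFrame η).choose_spec.choose_spec.choose
  have ht : IsFrame t := (hM.exists_isFrame η).choose_spec.choose_spec.choose_spec
  let C : X.Opens := componentOpen V
  haveI : Nonempty (C.ι ⁻¹ᵁ (W ⊓ U)).toScheme := nonempty_preimage_componentOpen V hU hη hW
  Scheme.ord (C.toScheme.germToFunctionField (C.ι ⁻¹ᵁ (W ⊓ U))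
    (C.ι.app (W ⊓ U) (ratio s t ht))) ⟨η, (mem_componentOpen V η).2 hη⟩

end Normal

section Stratifications

/-! ### Stratifications -/

/-- `X` has pure dimension `n`. -/
def IsPureDim (X : Scheme.{u}) (n : ℕ) : Prop :=
  ∀ Z ∈ irreducibleComponents X, topologicalKrullDim Z = n

/-- A birational morphism: an isomorphism over a dense open with dense preimage. -/
def IsBirational (f : Y ⟶ X) : Prop :=
  ∃ U : X.Opens, Dense (U : Set X) ∧ Dense ((f ⁻¹ᵁ U : Y.Opens) : Set Y) ∧ IsIso (f ∣_ U)

/-- The closed immersion `i` is a reduced Weil divisor: `D` is reduced and all its irreducible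
components have codimension one in `X`. -/
structure IsReducedWeilDivisor {D : Scheme.{u}} (i : D ⟶ X) : Prop where
  isClosedImmersion : IsClosedImmersion i
  isReduced : AlgebraicGeometry.IsReduced D
  coheight_eq_one (V : irreducibleComponents D) : Order.coheight (i (componentGenericPoint V)) = 1

/-- `f` factors through a reduced Weil divisor `D` of `X` by a proper birational `Y ⟶ D`. -/
def IsStratum (f : Y ⟶ X) : Prop :=
  ∃ (D : Scheme.{u}) (i : D ⟶ X) (g : Y ⟶ D),
    IsReducedWeilDivisor i ∧ IsProper g ∧ IsBirational g ∧ g ≫ i = f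

theorem IsStratum.isProper {f : Y ⟶ X} (hf : IsStratum f) : IsProper f := by
  obtain ⟨D, i, g, hi, hg, -, rfl⟩ := hf
  have := hi.isClosedImmersion
  infer_instance

theorem IsStratum.genericPoint_notMem_range {f : Y ⟶ X} (hf : IsStratum f)
    (V : irreducibleComponents X) : componentGenericPoint V ∉ Set.range f := by
  obtain ⟨D, i, g, hi, -, -, rfl⟩ := hf
  rintro ⟨y, hy⟩
  have hξ := isGenericPoint_componentGenericPoint V
  let T : irreducibleComponents D :=
    ⟨irreducibleComponent (g y), irreducibleComponent_mem_irreducibleComponents _⟩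
  have h1 : componentGenericPoint T ⤳ g y :=
    (isGenericPoint_componentGenericPoint T).specializes mem_irreducibleComponent
  have h2 : i (componentGenericPoint T) ⤳ componentGenericPoint V := by
    have := h1.map i.continuous
    rwa [← Scheme.Hom.comp_apply, hy] at this
  have hmax : ∀ ζ : X, ζ ⤳ componentGenericPoint V → componentGenericPoint V ⤳ ζ := by
    intro ζ hζ
    have h3 : V.1 ⊆ closure {ζ} := by
      rw [← hξ.def]; exact hζ.closure_subset
    have h4 := V.2.2 isIrreducible_singleton.closure h3
    exact hξ.specializes (h4 (subset_closure rfl))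
  have h5 : IsMax (i (componentGenericPoint T)) := by
    intro ζ hζ
    have h6 : ζ ⤳ i (componentGenericPoint T) := hζ
    exact h2.trans (hmax ζ (h6.trans h2))
  have h7 := hi.coheight_eq_one T
  rw [Order.coheight_eq_zero.2 h5] at h7
  exact zero_ne_one h7

/-- A stratification `X_0 ⟶ X_1 ⟶ ⋯ ⟶ X_n ⟶ X` of a scheme `X` of pure dimension `n`. -/
structure Stratification (X : Scheme.{u}) (n : ℕ) where
  /-- the schemes `X_i` -/
  obj : Fin (n + 1) → Scheme.{u}
  /-- the morphisms `f_i : X_i ⟶ X_{i+1}` -/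
  map (i : Fin n) : obj i.castSucc ⟶ obj i.succ
  /-- the morphism `X_n ⟶ X` -/
  q : obj (Fin.last n) ⟶ X
  isNormal (i : Fin (n + 1)) : IsNormal (obj i)
  isPureDim (i : Fin (n + 1)) : IsPureDim (obj i) i
  isStratum (i : Fin n) : IsStratum (map i)
  isProper_q : IsProper q
  isBirational_q : IsBirational q

namespace Stratification

variable {n : ℕ} (S : Stratification X n)

/-- The natural map `q_i : X_i ⟶ X`. -/
noncomputable def toBase (i : Fin (n + 1)) : S.obj i ⟶ X :=
  Fin.reverseInduction (motive := fun i => S.obj i ⟶ X) S.q (fun i g => S.map i ≫ g) i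

/-- The open set `U_i = X_i ∖ f_{i-1}(X_{i-1})`, where `X_{-1}` is empty. -/
def openPart : (i : Fin (n + 1)) → (S.obj i).Opens :=
  Fin.cases ⊤ fun i => ⟨(Set.range (S.map i))ᶜ, by
    have := (S.isStratum i).isProper
    exact (S.map i).isClosedMap.isClosed_range.isOpen_compl⟩

theorem genericPoint_mem_openPart (i : Fin n) (V : irreducibleComponents (S.obj i.succ)) :
    componentGenericPoint V ∈ S.openPart i.succ :=
  (S.isStratum i).genericPoint_notMem_range V

instance (i : Fin (n + 1)) : IsNormal (S.obj i) := S.isNormal i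

instance [IsNoetherian X] (i : Fin (n + 1)) : IsNoetherian (S.obj i) := by
  have key : ∀ {A B : Scheme.{u}} (f : A ⟶ B), IsProper f → IsNoetherian B → IsNoetherian A := by
    intro A B f _ _
    have := LocallyOfFiniteType.isLocallyNoetherian f
    have := QuasiCompact.compactSpace_of_compactSpace f
    exact {}
  induction i using Fin.reverseInduction with
  | last => exact key S.q S.isProper_q inferInstance
  | cast i ih => exact key (S.map i) (S.isStratum i).isProper ih

instance [IsNoetherian X] (i : Fin (n + 1)) : Finite (irreducibleComponents (S.obj i)) :=
  finite_irreducibleComponents_of_isNoetherian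

noncomputable instance [IsNoetherian X] (i : Fin (n + 1)) :
    Fintype (irreducibleComponents (S.obj i)) :=
  Fintype.ofFinite _

/-- The nodes of the tree: the irreducible components of all the `X_i`. -/
abbrev Node : Type u := Σ i : Fin (n + 1), irreducibleComponents (S.obj i)

/-- The component `W` of `X_i` is a child of the component `V` of `X_{i+1}`. -/
def IsChild (i : Fin n) (W : irreducibleComponents (S.obj i.castSucc))
    (V : irreducibleComponents (S.obj i.succ)) : Prop :=
  S.map i '' W.1 ⊆ V.1

/-- The tree of the stratification, with edges oriented from a child to its parent. The roots are
the components of `X_n` (there is only one if `X` is irreducible). -/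
def tree : Digraph S.Node where
  Adj w v := ∃ (i : Fin n) (W : irreducibleComponents (S.obj i.castSucc))
    (V : irreducibleComponents (S.obj i.succ)),
      w = ⟨i.castSucc, W⟩ ∧ v = ⟨i.succ, V⟩ ∧ S.IsChild i W V

theorem tree_adj {i : Fin n} {W : irreducibleComponents (S.obj i.castSucc)}
    {V : irreducibleComponents (S.obj i.succ)} :
    S.tree.Adj ⟨i.castSucc, W⟩ ⟨i.succ, V⟩ ↔ S.IsChild i W V := by
  constructor
  · rintro ⟨j, W', V', hW, hV, h⟩
    obtain rfl : i = j := Fin.castSucc_injective n (congrArg Sigma.fst hW)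
    obtain rfl := eq_of_heq (Sigma.mk.inj hW).2
    obtain rfl := eq_of_heq (Sigma.mk.inj hV).2
    exact h
  · exact fun h => ⟨i, W, V, rfl, rfl, h⟩

/-- A root-to-leaf path `V_n ← V_{n-1} ← ⋯ ← V_0` in the tree; its root is a component of `X_n`
and its leaf is a component of `X_0`. -/
def Path : Type u :=
  {v : (i : Fin (n + 1)) → irreducibleComponents (S.obj i) //
    ∀ i : Fin n, S.tree.Adj ⟨i.castSucc, v i.castSucc⟩ ⟨i.succ, v i.succ⟩}

/-- The leaf of a path. -/
def Path.leaf {S : Stratification X n} (σ : S.Path) : irreducibleComponents (S.obj 0) := σ.1 0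

instance [IsNoetherian X] : Finite S.Path :=
  inferInstanceAs (Finite {v : (i : Fin (n + 1)) → irreducibleComponents (S.obj i) //
    ∀ i : Fin n, S.tree.Adj ⟨i.castSucc, v i.castSucc⟩ ⟨i.succ, v i.succ⟩})

noncomputable instance [IsNoetherian X] : Fintype S.Path := Fintype.ofFinite _

end Stratification

end Stratifications

section ChernClasses

/-! ### Trivialized stratifications and truncated Chern classes -/

/-- A trivialization of the line bundle `L` over `S`: a frame of `q_i^* L` over each `U_i`. -/
structure Trivialization {n : ℕ} (L : X.Modules) (S : Stratification X n) where
  /-- the frame over `U_i` -/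
  frame (i : Fin (n + 1)) : Γ((Scheme.Modules.pullback (S.toBase i)).obj L, S.openPart i)
  isFrame (i : Fin (n + 1)) : IsFrame (frame i)

/-- A fractional trivialization `(1 / d) e` of the `ℚ`-line bundle `N` over `S`. -/
structure FractionalTrivialization {n : ℕ} (N : QLineBundle X) (S : Stratification X n) where
  /-- the denominator `d` -/
  d : ℕ
  d_pos : 0 < d
  /-- a line bundle whose class is `N^{⊗ d}` -/
  bundle : X.Modules
  isLineBundle : IsLineBundle bundle
  powComesFrom : N.PowComesFrom d bundle
  /-- the trivialization `e` -/
  triv : Trivialization bundle S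

namespace Stratification

variable {n : ℕ} (S : Stratification X n)

/-- The total cycle group `⨁_k ⨁_V ℚ · [V]`, where `V` runs through the components of `X_k`. -/
abbrev CycleGroup : Type u := S.Node →₀ ℚ

/-- The cycle `[X]`, the sum of the components of `X_n`. -/
noncomputable def fundamentalCycle [IsNoetherian X] : S.CycleGroup :=
  ∑ V : irreducibleComponents (S.obj (Fin.last n)), Finsupp.single ⟨Fin.last n, V⟩ 1

/-- For a component `V` of `X_0` and `p : X ⟶ Spec k`, the degree over `k` of the residue field
`K` at the point of `V = Spec K`. -/
noncomputable def pointDegree {k : Type u} [Field k] (p : X ⟶ Spec (.of k))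
    (V : irreducibleComponents (S.obj 0)) : ℕ :=
  let x := componentGenericPoint V
  letI : Algebra k ((S.obj 0).residueField x) :=
    (Spec.preimage ((S.obj 0).fromSpecResidueField x ≫ S.toBase 0 ≫ p)).hom.toAlgebra
  Module.finrank k ((S.obj 0).residueField x)

/-- The degree map `∑_V α_V [V] ↦ ∑_V α_V deg_k V` on cycles of dimension zero, precomposed with
the projection of the total cycle group to its summand of dimension zero. -/
noncomputable def degree [IsNoetherian X] {k : Type u} [Field k] (p : X ⟶ Spec (.of k))
    (z : S.CycleGroup) : ℚ :=
  ∑ V : irreducibleComponents (S.obj 0), z ⟨0, V⟩ * S.pointDegree p V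

end Stratification

namespace FractionalTrivialization

variable [IsNoetherian X] {n : ℕ} {N : QLineBundle X} {S : Stratification X n}
  (T : FractionalTrivialization N S)

/-- The multiplicity `m` of the frame over `U_{i+1}`, as a rational section of `q_{i+1}^* L` on the
component `V` of `X_{i+1}`, at the generic point of `f_i(W)`. -/
noncomputable def multiplicity (i : Fin n) (W : irreducibleComponents (S.obj i.castSucc))
    (V : irreducibleComponents (S.obj i.succ)) (h : S.IsChild i W V) : ℤ :=
  multiplicityAt V (T.isLineBundle.pullback (S.toBase i.succ)) (S.genericPoint_mem_openPart i V)
    (T.triv.frame i.succ) (S.map i (componentGenericPoint W))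
    (h ⟨_, (isGenericPoint_componentGenericPoint W).mem, rfl⟩)

/-- The marking `m / d` of the edge from `W` to `V`. -/
noncomputable def marking (i : Fin n) (W : irreducibleComponents (S.obj i.castSucc))
    (V : irreducibleComponents (S.obj i.succ)) (h : S.IsChild i W V) : ℚ :=
  T.multiplicity i W V h / T.d

open Classical in
/-- The action of the truncated first Chern class of level `l` on the cycle `[V]`: the sum of the
`(m_W / d) [W]` over the children `W` of `V` with `m_W > 0` if `l = 0` and with `m_W < 0` if
`l = 1`, and zero for all other `l`. -/
noncomputable def chernOnNode (l : ℤ) (v : S.Node) : S.CycleGroup :=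
  Fin.cases (motive := fun i => irreducibleComponents (S.obj i) → S.CycleGroup)
    (fun _ => 0)
    (fun i V => ∑ W : {W : irreducibleComponents (S.obj i.castSucc) // S.IsChild i W V},
      if (l = 0 ∧ 0 < T.multiplicity i W V W.2) ∨ (l = 1 ∧ T.multiplicity i W V W.2 < 0) then
        ((T.multiplicity i W V W.2 : ℚ) / T.d) • Finsupp.single ⟨i.castSucc, W⟩ 1
      else 0)
    v.1 v.2

/-- The truncated first Chern class of level `l`, as an endomorphism of the cycle group. -/
noncomputable def chern (l : ℤ) : Module.End ℚ S.CycleGroup :=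
  Finsupp.linearCombination ℚ (T.chernOnNode l)

/-- The truncated powers of the first Chern class. -/
noncomputable def chernPow : ℕ → ℤ → Module.End ℚ S.CycleGroup
  | 0, l => if l = 0 then LinearMap.id else 0
  | k + 1, l => chernPow k l ∘ₗ T.chern 0 + chernPow k (l - 1) ∘ₗ T.chern 1

/-- The marking of the `i`-th edge of a path. -/
noncomputable def pathMarking (σ : S.Path) (i : Fin n) : ℚ :=
  T.marking i (σ.1 i.castSucc) (σ.1 i.succ) (S.tree_adj.1 (σ.2 i))

/-- The product of the markings along the edges of a path. -/
noncomputable def pathProduct (σ : S.Path) : ℚ :=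
  ∏ i : Fin n, T.pathMarking σ i

/-- The index of a path: the number of its edges with a negative marking. -/
noncomputable def pathIndex (σ : S.Path) : ℕ :=
  Nat.card {i : Fin n // T.pathMarking σ i < 0}

end FractionalTrivialization

end ChernClasses

end StratifiedChern

open StratifiedChern

namespace StratifiedChern

/-! The geometry enters only through finitely many components and the marking of each edge; the rest
is bookkeeping over a layered graph. The recursion for the truncated powers peels off the operator
applied first, hence the edge next to the root. If the marking of that edge is positive, it passes
from `c_1^{k+1}_{[l]}` to `c_1^k_{[l]}`; if negative, to `c_1^k_{[l-1]}`; an edge marked zero is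
dropped by both, in accordance with the vanishing of the product of any path through it. Expanding
down to dimension zero thus gives one term per path: its product of markings times the degree of its
leaf, at the level that counts its negative edges.

`sum_mul_eq_sum_paths` performs this expansion for arbitrary rational weights on pairs of
consecutive vertices. It sums over all tuples of vertices, not only over paths, so that the tuples
form a plain product. `weight` makes it applicable: by `chern_single` the Chern operators are sums
over all components of the layer below, and by `prod_weight_eq_zero` the superfluous tuples
contribute nothing. -/

/-! ### Path expansion in a layered graph with signed weights -/

/-- A family of functions `G i l` that satisfies the recursion of truncated powers, with edge
weights `m`, is summed up by paths: only those with exactly `l` negative edges contribute. -/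
theorem sum_mul_eq_sum_paths {n : ℕ} {A : Fin (n + 1) → Type*} [∀ i, Fintype (A i)]
    (m : ∀ i : Fin n, A i.castSucc → A i.succ → ℚ) (δ : A 0 → ℚ)
    (G : ∀ i : Fin (n + 1), ℤ → A i → ℚ)
    (h0 : ∀ l V, G 0 l V = if l = 0 then δ V else 0)
    (hs : ∀ (i : Fin n) l V, G i.succ l V = ∑ W, ((if 0 < m i W V then m i W V else 0) *
      G i.castSucc l W + (if m i W V < 0 then m i W V else 0) * G i.castSucc (l - 1) W))
    (f : A (Fin.last n) → ℚ) (l : ℤ) :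
    ∑ V, f V * G (Fin.last n) l V =
      ∑ v : ∀ i, A i, if (∑ i : Fin n, if m i (v i.castSucc) (v i.succ) < 0 then (1 : ℤ) else 0) = l
        then f (v (Fin.last n)) * (∏ i, m i (v i.castSucc) (v i.succ)) * δ (v 0) else 0 := by
  induction n generalizing l with
  | zero =>
    let _ : Unique (Fin (0 + 1)) := inferInstanceAs (Unique (Fin 1))
    refine Fintype.sum_equiv (Equiv.piUnique A).symm _ _ fun V => ?_
    have hV : (Equiv.piUnique A).symm V 0 = V := (Equiv.piUnique A).apply_symm_apply V
    have hG : G (Fin.last 0) l V = if l = 0 then δ V else 0 := h0 l V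
    simp only [hG, Finset.univ_eq_empty, Finset.sum_empty, Finset.prod_empty, mul_one,
      eq_comm (a := (0 : ℤ)), mul_ite, mul_zero]
    rw [hV]
    rfl
  | succ n ih =>
    -- The top layer is removed. The induction hypothesis holds for every function `f` on the new
    -- top layer, so `f` can absorb the weight of the removed edge.
    have key := ih (A := fun i => A i.castSucc) (fun i => m i.castSucc) δ
      (fun i => G i.castSucc) h0 (fun i => hs i.castSucc)
    have hlast : ∀ V, G (Fin.last (n + 1)) l V = _ := hs (Fin.last n) l
    have hsplit : ∑ V, f V * G (Fin.last (n + 1)) l V =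
        ∑ V, (∑ W, f V * (if 0 < m (Fin.last n) W V then m (Fin.last n) W V else 0) *
            G (Fin.last n).castSucc l W +
          ∑ W, f V * (if m (Fin.last n) W V < 0 then m (Fin.last n) W V else 0) *
            G (Fin.last n).castSucc (l - 1) W) := by
      refine Finset.sum_congr rfl fun V _ => ?_
      rw [hlast, Finset.mul_sum, ← Finset.sum_add_distrib]
      exact Finset.sum_congr rfl fun W _ => by ring
    -- A tuple is its top vertex `V` together with a tuple `v` of the lower layers; for fixed `V`
    -- both sides are compared one `v` at a time.
    rw [hsplit, ← (Fin.snocEquiv A).sum_comp, Fintype.sum_prod_type]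
    refine Finset.sum_congr rfl fun V _ => ?_
    rw [key, key, ← Finset.sum_add_distrib]
    refine Finset.sum_congr rfl fun v _ => ?_
    have e1 : ∀ i : Fin (n + 1), Fin.snocEquiv A (V, v) i.castSucc = v i := fun i => by
      simp [Fin.snocEquiv]
    have e2 : Fin.snocEquiv A (V, v) (Fin.last n).succ = V := by
      change Fin.snocEquiv A (V, v) (Fin.last (n + 1)) = V
      simp [Fin.snocEquiv]
    have e3 : ∀ i : Fin n, Fin.snocEquiv A (V, v) i.castSucc.succ = v i.succ := fun i => e1 i.succ
    have e4 : Fin.snocEquiv A (V, v) 0 = v 0 := e1 0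
    rw [Fin.sum_univ_castSucc, Fin.prod_univ_castSucc, e4]
    simp only [e1, e3]
    change _ = if _ then f (Fin.snocEquiv A (V, v) (Fin.last n).succ) * _ * _ else 0
    rw [e2]
    -- At most one of the two terms survives. A negative last edge raises the count by one, which
    -- matches the level `l - 1`; for a zero edge both sides vanish.
    rcases lt_trichotomy (m (Fin.last n) (v (Fin.last n)) V) 0 with hm | hm | hm
    · simp only [hm, hm.not_gt, if_true, if_false, mul_zero, zero_mul, ite_self, zero_add,
        eq_sub_iff_add_eq]
      split_ifs <;> ring
    · simp [hm]
    · simp only [hm, hm.not_gt, if_true, if_false, mul_zero, zero_mul, ite_self, add_zero]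
      split_ifs <;> ring

/-! ### The degree as a linear form -/

namespace Stratification

variable {X : Scheme.{u}} {n : ℕ} (S : Stratification X n)

/-- The degree as a linear form on the cycle group. -/
noncomputable def degreeHom [IsNoetherian X] {k : Type u} [Field k] (p : X ⟶ Spec (.of k)) :
    S.CycleGroup →ₗ[ℚ] ℚ where
  toFun := S.degree p
  map_add' z w := by simp [degree, add_mul, Finset.sum_add_distrib]
  map_smul' c z := by simp [degree, mul_assoc, Finset.mul_sum]

theorem degreeHom_single_zero [IsNoetherian X] {k : Type u} [Field k] (p : X ⟶ Spec (.of k))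
    (V : irreducibleComponents (S.obj 0)) :
    S.degreeHom p (Finsupp.single ⟨0, V⟩ 1) = S.pointDegree p V := by
  classical
  change ∑ W, _ = _
  rw [Finset.sum_eq_single V]
  · simp
  · intro W _ hW
    have h : (⟨0, V⟩ : S.Node) ≠ ⟨0, W⟩ := fun h => hW (eq_of_heq (Sigma.mk.inj h).2).symm
    rw [Finsupp.single_eq_of_ne' h, zero_mul]
  · simp

end Stratification

/-! ### Chern operators in terms of edge weights -/

namespace FractionalTrivialization

variable {X : Scheme.{u}} [IsNoetherian X] {n : ℕ} {N : QLineBundle X} {S : Stratification X n}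
  (T : FractionalTrivialization N S)

open Classical in
/-- The marking of the edge from `W` to `V`, extended by zero to pairs that form no edge. -/
noncomputable def weight (i : Fin n) (W : irreducibleComponents (S.obj i.castSucc))
    (V : irreducibleComponents (S.obj i.succ)) : ℚ :=
  if h : S.IsChild i W V then T.marking i W V h else 0

theorem weight_of_isChild {i : Fin n} {W : irreducibleComponents (S.obj i.castSucc)}
    {V : irreducibleComponents (S.obj i.succ)} (h : S.IsChild i W V) :
    T.weight i W V = T.marking i W V h :=
  dif_pos h

theorem weight_of_not_isChild {i : Fin n} {W : irreducibleComponents (S.obj i.castSucc)}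
    {V : irreducibleComponents (S.obj i.succ)} (h : ¬ S.IsChild i W V) :
    T.weight i W V = 0 :=
  dif_neg h

/-- Since `d > 0`, division by it preserves signs. The Chern operators test the sign of the
multiplicity while the index tests that of the marking, so the two must be matched. -/
theorem marking_pos_iff {i : Fin n} {W : irreducibleComponents (S.obj i.castSucc)}
    {V : irreducibleComponents (S.obj i.succ)} (h : S.IsChild i W V) :
    0 < T.marking i W V h ↔ 0 < T.multiplicity i W V h := by
  have hd : (0 : ℚ) < T.d := by exact_mod_cast T.d_pos
  rw [marking, div_pos_iff_of_pos_right hd, Int.cast_pos]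

theorem marking_neg_iff {i : Fin n} {W : irreducibleComponents (S.obj i.castSucc)}
    {V : irreducibleComponents (S.obj i.succ)} (h : S.IsChild i W V) :
    T.marking i W V h < 0 ↔ T.multiplicity i W V h < 0 := by
  have hd : (0 : ℚ) < T.d := by exact_mod_cast T.d_pos
  rw [marking, div_lt_iff₀ hd, zero_mul, Int.cast_lt_zero]

/-- Replaces the sum over children, whose index type depends on `V`, by a sum over the whole layer
below; this is the shape of the recursion in `sum_mul_eq_sum_paths`. -/
theorem chern_single (l : ℤ) (i : Fin n) (V : irreducibleComponents (S.obj i.succ)) :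
    T.chern l (Finsupp.single ⟨i.succ, V⟩ 1) =
      ∑ W, (if (l = 0 ∧ 0 < T.weight i W V) ∨ (l = 1 ∧ T.weight i W V < 0) then
        T.weight i W V else 0) • Finsupp.single (⟨i.castSucc, W⟩ : S.Node) (1 : ℚ) := by
  classical
  rw [chern, Finsupp.linearCombination_single, one_smul]
  change ∑ W : {W : irreducibleComponents (S.obj i.castSucc) // S.IsChild i W V}, _ = _
  -- A component that is not a child has weight zero, so its term vanishes whichever way the sign
  -- test goes.
  rw [← Finset.sum_filter_of_ne (p := fun W => S.IsChild i W V) fun W _ hW => by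
    by_contra hc
    exact hW (by simp [T.weight_of_not_isChild hc])]
  rw [Finset.sum_subtype (p := fun W => S.IsChild i W V) _ (by simp)]
  refine Finset.sum_congr (by congr!) fun W _ => ?_
  simp only [T.weight_of_isChild W.2, T.marking_pos_iff, T.marking_neg_iff, ite_smul, zero_smul]
  rfl

/-- A tuple that is not a path has a consecutive pair that is no edge, and that pair supplies a zero
factor. -/
theorem prod_weight_eq_zero {v : (i : Fin (n + 1)) → irreducibleComponents (S.obj i)}
    (hv : ¬ ∀ i : Fin n, S.tree.Adj ⟨i.castSucc, v i.castSucc⟩ ⟨i.succ, v i.succ⟩) :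
    ∏ i, T.weight i (v i.castSucc) (v i.succ) = 0 := by
  obtain ⟨i, hi⟩ := not_forall.1 hv
  exact Finset.prod_eq_zero (Finset.mem_univ i)
    (T.weight_of_not_isChild fun h => hi (S.tree_adj.2 h))

theorem weight_path (σ : S.Path) (i : Fin n) :
    T.weight i (σ.1 i.castSucc) (σ.1 i.succ) = T.pathMarking σ i :=
  T.weight_of_isChild _

theorem sum_ite_weight_path (σ : S.Path) :
    (∑ i : Fin n, if T.weight i (σ.1 i.castSucc) (σ.1 i.succ) < 0 then (1 : ℤ) else 0) =
      T.pathIndex σ := by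
  simp only [weight_path]
  rw [pathIndex, Nat.card_eq_fintype_card, Fintype.card_subtype, Finset.sum_boole]

end FractionalTrivialization

end StratifiedChern

/-! ### The path formula for the degree -/

open StratifiedChern Stratification FractionalTrivialization in
theorem mainTheorem4 {k : Type u} [Field k] {X : Scheme.{u}} (p : X ⟶ Spec (.of k))
    [LocallyOfFiniteType p] [IsNoetherian X] [AlgebraicGeometry.IsReduced X]
    (n : ℕ) (hX : IsPureDim X n) (N : QLineBundle X) (S : Stratification X n)
    (T : FractionalTrivialization N S) (l : ℤ) :
    S.degree p (T.chernPow n l S.fundamentalCycle) =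
      ∑ σ : S.Path with (T.pathIndex σ : ℤ) = l, T.pathProduct σ * S.pointDegree p σ.leaf := by
  classical
  -- `G i l V` is the degree of the `i`-th truncated power on a component of `X_i`: the exponent
  -- equals the dimension, so the cycle lands in dimension zero. The constant function `1` gives the
  -- coefficients of the fundamental cycle.
  have h := sum_mul_eq_sum_paths T.weight (fun V => (S.pointDegree p V : ℚ))
    (fun i l V => S.degreeHom p (T.chernPow i l (Finsupp.single ⟨i, V⟩ 1)))
    (fun l V => by
      rw [← S.degreeHom_single_zero]
      change S.degreeHom p ((if l = 0 then LinearMap.id else 0 : Module.End ℚ S.CycleGroup) _) = _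
      split_ifs <;> simp)
    (fun i l V => by
      change S.degreeHom p (T.chernPow i l (T.chern 0 _) + T.chernPow i (l - 1) (T.chern 1 _)) = _
      simp only [chern_single, true_and, zero_ne_one, one_ne_zero, false_and, or_false, false_or,
        map_add, map_sum, map_smul, smul_eq_mul, ← Finset.sum_add_distrib]
      rfl)
    (fun _ => 1) l
  change S.degreeHom p _ = _
  rw [fundamentalCycle, map_sum, map_sum]
  simp only [one_mul, Fin.val_last] at h
  rw [h, Finset.sum_filter]
  let P : ((i : Fin (n + 1)) → irreducibleComponents (S.obj i)) → Prop := fun v =>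
    ∀ i : Fin n, S.tree.Adj ⟨i.castSucc, v i.castSucc⟩ ⟨i.succ, v i.succ⟩
  -- Only tuples that are paths can contribute a nonzero term.
  rw [← Finset.sum_filter_of_ne (p := P) fun v _ hv => by
    by_contra hP
    exact hv (by rw [T.prod_weight_eq_zero hP, zero_mul, ite_self])]
  have hF : Fintype (Subtype P) := Fintype.ofFinite _
  rw [Finset.sum_subtype (p := P) (F := hF) _ (by simp)]
  -- `S.Path` unfolds to `Subtype P`, so the identity serves as the bijection.
  refine Fintype.sum_equiv (M := ℚ) (ι := Subtype P) (κ := S.Path) (Equiv.refl S.Path) _ _ fun σ => ?_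
  have h1 := T.sum_ite_weight_path σ
  have h2 : ∏ i, T.weight i (σ.1 i.castSucc) (σ.1 i.succ) = T.pathProduct σ :=
    Finset.prod_congr rfl fun i _ => T.weight_path σ i
  rw [h1, h2]
  rfl
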